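/- Let $\mathbb{I}$ be one of the following integer rings, with scalars $\mathbb{K}$ having $D_r$ real components: $\mathbb{Z}$ ($\mathbb{K}=\mathbb{R}$, $D_r=1$); the Gaussian integers $\mathbb{Z}+\mathbb{Z}i$ or the Eisenstein integers $\mathbb{Z}+\mathbb{Z}\omega$, $\omega=e^{2\pi i/3}$ ($\mathbb{K}=\mathbb{C}$, $D_r=2$); the Lipschitz integers $\mathbb{Z}+\mathbb{Z}i+\mathbb{Z}j+\mathbb{Z}k$ or the Hurwitz integers (quaternions whose components are all in $\mathbb{Z}$ or all in $\mathbb{Z}+\frac12$) ($\mathbb{K}=\mathbb{H}$, $D_r=4$). Let $G\in\mathbb{K}^{N\times K}$ have columns $g_1,\dots,g_K$ that are linearly independent over $\mathbb{K}$ (acting from the right), let $\Lambda(G)=\{G\zeta : \zeta\in\mathbb{I}^K\}$ be the lattice generated by $G$ over $\mathbb{I}$, and let $\mathrm{vol}(\Lambda(G))=\sqrt{\det(G^{\mathsf H}G)}$, where for $\mathbb{K}=\mathbb{H}$ the determinant is $\det(A)=\sqrt{|\det A_c|}$ with $A_c=\begin{bmatrix}A_1&-A_2\\ \overline{A_2}&\overline{A_1}\end{bmatrix}$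 for $A=A_1+A_2j$ with $A_1,A_2$ complex. Let $\Omega(G)=\prod_{k=1}^K\|g_k\|/\mathrm{vol}(\Lambda(G))$ be the orthogonality defect. For $k=1,\dots,K$ let the $k$-th successive minimum $\mu_{\mathbb{I},k}$ be the infimum of all $\mu$ such that the points of $\Lambda(G)$ of Euclidean norm at most $\mu$ span a (right) $\mathbb{K}$-space of dimension at least $k$. Let $\eta_n$ be Hermite's constant, i.e. the supremum of $\mu_1^2/\mathrm{vol}^{2/n}$ over all real lattices (over $\mathbb{Z}$) of rank $n$. Let $G_{\mathbb{I}}$ be the real $D_rK\times D_rK$ generator matrix of $\mathbb{I}^K$: the identity for the integers, the Gaussian integers and the Lipschitz integers, and $$G_{\mathcal E}=\begin{bmatrix} I_K & -\tfrac12 I_K\\ 0 & \tfrac{\sqrt3}{2} I_K\end{bmatrix},\qquad G_{\mathcal H}=\begin{bmatrix} I_K&0&0&\tfrac12 I_K\\ 0&I_K&0&\tfrac12 I_K\\ 0&0&I_K&\tfrac12 I_K\\ 0&0&0&\tfrac12 I_K\end{bmatrix}$$ for the Eisenstein and the Hurwitz integers. Then, for every $L=1,\dots,K$, $$\prod_{l=1}^{L}\mu_{\mathbb{I},l}^2\le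 \eta_{D_rK}^{L}\,|\det(G_{\mathbb{I}})|^{\frac{2L}{D_rK}}\,\mathrm{vol}^{\frac{2L}{K}}(\Lambda(G)).$$ Moreover, if $T\in\mathbb{I}^{K\times K}$ is such that the columns of $G_{\mathrm{tra}}=GT$ are shortest independent lattice vectors, i.e. they are linearly independent over $\mathbb{K}$ (from the right) and the $k$-th column has norm $\mu_{\mathbb{I},k}$ for $k=1,\dots,K$, then $$\Omega(G_{\mathrm{tra}})\le \eta_{D_rK}^{\frac K2}\,|\det(G_{\mathbb{I}})|^{\frac1{D_r}}.$$ -/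

import Mathlib

open scoped Matrix Kronecker Quaternion

noncomputable section

namespace GenLattice

/-! ### Determinants of Hermitian matrices over `ℝ`, `ℂ` and `ℍ` -/

/-- The (real-valued) determinant of a Hermitian matrix over `𝕂`. It is only instantiated for
`𝕂 = ℝ, ℂ, ℍ` and only applied to Gram matrices `Gᴴ * G`. -/
class HermitianDet (𝕂 : Type) where
  hdet : ∀ {n : ℕ}, Matrix (Fin n) (Fin n) 𝕂 → ℝ

instance : HermitianDet ℝ where
  hdet A := A.det

/-- The determinant of a complex Hermitian matrix is a real number. -/
instance : HermitianDet ℂ where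
  hdet A := A.det.re

/-- First complex component: `q = (a + b i) + (c + d i) j ↦ a + b i`. -/
def quatFst (q : ℍ[ℝ]) : ℂ := ⟨q.re, q.imI⟩

/-- Second complex component: `q = (a + b i) + (c + d i) j ↦ c + d i`. -/
def quatSnd (q : ℍ[ℝ]) : ℂ := ⟨q.imJ, q.imK⟩

/-- The equivalent complex matrix of a quaternion matrix `M = M₁ + M₂ j`:
it is the block matrix with rows `(M₁, -M₂)` and `(conj M₂, conj M₁)`. -/
def complexRep {m n : ℕ} (M : Matrix (Fin m) (Fin n) ℍ[ℝ]) :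
    Matrix (Fin m ⊕ Fin m) (Fin n ⊕ Fin n) ℂ :=
  Matrix.fromBlocks (M.map quatFst) (-M.map quatSnd)
    (M.map fun q => star (quatSnd q)) (M.map fun q => star (quatFst q))

/-- The determinant of a quaternion matrix is taken to be the (normalized) Dieudonné determinant,
the square root of the Study determinant `det (complexRep A)`, which is a nonnegative real number.
On Gram matrices it agrees with the Moore determinant. -/
instance : HermitianDet ℍ[ℝ] where
  hdet A := Real.sqrt ‖(complexRep A).det‖

/-! ### Lattices, volume, orthogonality defect, successive minima -/

section General

variable {𝕂 : Type} [NormedDivisionRing 𝕂] [StarRing 𝕂] [HermitianDet 𝕂] {N K : ℕ}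

/-- The Euclidean norm of a vector over `𝕂`. -/
def euclNorm (v : Fin N → 𝕂) : ℝ := Real.sqrt (∑ i, ‖v i‖ ^ 2)

/-- `G` is a generator matrix: its columns are linearly independent. As lattice points are
combinations `∑ k, g_k * ζ_k`, vectors over `𝕂` are regarded as right vectors. -/
def IsGenerator (G : Matrix (Fin N) (Fin K) 𝕂) : Prop :=
  LinearIndependent 𝕂ᵐᵒᵖ G.col

/-- The lattice generated by the columns of `G` over the set of integers `I`. -/
def latticePoints (I : Set 𝕂) (G : Matrix (Fin N) (Fin K) 𝕂) : Set (Fin N → 𝕂) :=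
  {v | ∃ ζ : Fin K → 𝕂, (∀ k, ζ k ∈ I) ∧ v = G *ᵥ ζ}

/-- The volume of the lattice with generator matrix `G`. -/
def vol (G : Matrix (Fin N) (Fin K) 𝕂) : ℝ := Real.sqrt (HermitianDet.hdet (Gᴴ * G))

/-- The orthogonality defect of `G`. -/
def orthDefect (G : Matrix (Fin N) (Fin K) 𝕂) : ℝ := (∏ k, euclNorm (G.col k)) / vol G

/-- The `k`-th successive minimum (`k = 1, …, K`): the smallest radius of a ball around the origin
whose lattice points span a right `𝕂`-vector space of dimension at least `k`. -/
def succMin (I : Set 𝕂) (G : Matrix (Fin N) (Fin K) 𝕂) (k : ℕ) : ℝ :=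
  sInf {r : ℝ | k ≤ Module.finrank 𝕂ᵐᵒᵖ
    (Submodule.span 𝕂ᵐᵒᵖ (latticePoints I G ∩ {v | euclNorm v ≤ r}))}

/-- The columns of `T` are integer vectors over `I` that describe shortest independent vectors of
the lattice: the columns of `G * T` are linearly independent and the norm of the `k`-th one
is the `k`-th successive minimum. -/
def IsShortestIndependent (I : Set 𝕂) (G : Matrix (Fin N) (Fin K) 𝕂)
    (T : Matrix (Fin K) (Fin K) 𝕂) : Prop :=
  (∀ i j, T i j ∈ I) ∧ LinearIndependent 𝕂ᵐᵒᵖ (G * T).col ∧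
    ∀ k : Fin K, euclNorm ((G * T).col k) = succMin I G (k + 1)

end General

/-- Hermite's constant `η_n`: the supremum, over the real lattices of rank `n`, of the squared
length of a shortest nonzero vector over the `(2 / n)`-th power of the volume. -/
def hermiteConst (n : ℕ) : ℝ :=
  sSup {x : ℝ | ∃ A : Matrix (Fin n) (Fin n) ℝ, IsGenerator A ∧
    x = succMin (Set.range ((↑) : ℤ → ℝ)) A 1 ^ 2 / vol A ^ ((2 : ℝ) / n)}

/-! ### The integer rings -/

/-- The five integer rings: the integers, the Gaussian and Eisenstein integers (complex), the
Lipschitz and Hurwitz integers (quaternionic). -/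
inductive IntegerRing : Type
  | int
  | gauss
  | eisenstein
  | lipschitz
  | hurwitz

namespace IntegerRing

/-- The scalars over which lattices over the integer ring are considered. -/
abbrev Scalar : IntegerRing → Type
  | int => ℝ
  | gauss => ℂ
  | eisenstein => ℂ
  | lipschitz => ℍ[ℝ]
  | hurwitz => ℍ[ℝ]

instance instNormedDivisionRing : (I : IntegerRing) → NormedDivisionRing I.Scalar
  | int => inferInstanceAs (NormedDivisionRing ℝ)
  | gauss => inferInstanceAs (NormedDivisionRing ℂ)
  | eisenstein => inferInstanceAs (NormedDivisionRing ℂ)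
  | lipschitz => inferInstanceAs (NormedDivisionRing ℍ[ℝ])
  | hurwitz => inferInstanceAs (NormedDivisionRing ℍ[ℝ])

instance instStarRing : (I : IntegerRing) → StarRing I.Scalar
  | int => inferInstanceAs (StarRing ℝ)
  | gauss => inferInstanceAs (StarRing ℂ)
  | eisenstein => inferInstanceAs (StarRing ℂ)
  | lipschitz => inferInstanceAs (StarRing ℍ[ℝ])
  | hurwitz => inferInstanceAs (StarRing ℍ[ℝ])

instance instHermitianDet : (I : IntegerRing) → HermitianDet I.Scalar
  | int => inferInstanceAs (HermitianDet ℝ)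
  | gauss => inferInstanceAs (HermitianDet ℂ)
  | eisenstein => inferInstanceAs (HermitianDet ℂ)
  | lipschitz => inferInstanceAs (HermitianDet ℍ[ℝ])
  | hurwitz => inferInstanceAs (HermitianDet ℍ[ℝ])

/-- The elements of the integer ring. -/
def elements : (I : IntegerRing) → Set I.Scalar
  | int => Set.range ((↑) : ℤ → ℝ)
  | gauss => {c : ℂ | ∃ a b : ℤ, c = a + b * Complex.I}
  | eisenstein =>
      {c : ℂ | ∃ a b : ℤ, c = a + b * Complex.exp (2 * Real.pi / 3 * Complex.I)}
  | lipschitz => {q : ℍ[ℝ] | ∃ a b c d : ℤ, q = ⟨a, b, c, d⟩}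
  | hurwitz => {q : ℍ[ℝ] | (∃ a b c d : ℤ, q = ⟨a, b, c, d⟩) ∨
      ∃ a b c d : ℤ, q = ⟨a + 1 / 2, b + 1 / 2, c + 1 / 2, d + 1 / 2⟩}

/-- The number `D` of real components per scalar. -/
def realDim : IntegerRing → ℕ
  | int => 1
  | gauss => 2
  | eisenstein => 2
  | lipschitz => 4
  | hurwitz => 4

/-- A real `D × D` generator matrix of the integer ring: its columns are the real coordinates of
a `ℤ`-basis of the ring. -/
def baseMatrix : (I : IntegerRing) → Matrix (Fin I.realDim) (Fin I.realDim) ℝ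
  | int => (1 : Matrix (Fin 1) (Fin 1) ℝ)
  | gauss => (1 : Matrix (Fin 2) (Fin 2) ℝ)
  | eisenstein => !![1, -1 / 2; 0, Real.sqrt 3 / 2]
  | lipschitz => (1 : Matrix (Fin 4) (Fin 4) ℝ)
  | hurwitz => !![1, 0, 0, 1 / 2; 0, 1, 0, 1 / 2; 0, 0, 1, 1 / 2; 0, 0, 0, 1 / 2]

/-- The real `DK × DK` generator matrix of the `K`-fold product of the integer ring: the block
matrix whose block with index `(a, b)` is the entry `(a, b)` of `baseMatrix` times the `K × K`
identity matrix. -/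
def genMatrix (I : IntegerRing) (K : ℕ) :
    Matrix (Fin I.realDim × Fin K) (Fin I.realDim × Fin K) ℝ :=
  I.baseMatrix ⊗ₖ (1 : Matrix (Fin K) (Fin K) ℝ)

end IntegerRing

end GenLattice

end

open GenLattice

/-!
The heart of the matter is Minkowski's second theorem, with Hermite's constant, for the real lattice
of rank `D * K` that underlies `Λ(G)`.

For a real lattice, take an orthonormal basis adapted to the chain of subspaces spanned by the
lattice vectors shorter than given bounds `l 0 ≤ l 1 ≤ …`, and divide the `i`-th coordinate by
`l i`. If the vectors shorter than `l i` span a space of dimension at most `i`, the result is a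
lattice without nonzero vectors of length less than one, so that Hermite's inequality (the supremum
in Hermite's constant is finite by Minkowski's first theorem) bounds `∏ l i` by the volume. This is
`prod_sq_le_hermiteConst_pow_mul_det_gram`; neither Gram–Schmidt vectors nor the attainment of the
successive minima are needed.

Over `𝕂`, lattice vectors shorter than the `k`-th successive minimum span a right `𝕂`-space of
dimension less than `k`, hence a real space of dimension at most `D * (k - 1)`. So each successive
minimum can be used for `D` consecutive bounds `l i`. The volume of the real lattice is
`|det G_I| * vol G ^ D`, because the real determinant of the multiplication by a Gram matrix `A` is
`hdet A ^ D` (`RealModel.det_gram_latticeBasis`). The product of the first `L` successive minima is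
compared with the product of all of them by monotonicity, and the orthogonality defect is bounded
using that a sublattice of full rank has at least the volume of the lattice
(`RealModel.vol_le_vol_mul`). The structure `RealModel` collects what is used of an integer ring; the
five rings are treated in the last part.
-/

open GenLattice

namespace GenLattice

/-! ### Generator matrices and successive minima -/

section DivisionRing

variable {𝕂 : Type} [NormedDivisionRing 𝕂] {N K : ℕ}

theorem mulVec_eq_sum_op_smul_col (G : Matrix (Fin N) (Fin K) 𝕂) (ζ : Fin K → 𝕂) :
    G *ᵥ ζ = ∑ k, MulOpposite.op (ζ k) • G.col k := by
  ext i
  simp [Matrix.mulVec, dotProduct, Matrix.col]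

theorem isGenerator_iff (G : Matrix (Fin N) (Fin K) 𝕂) :
    IsGenerator G ↔ ∀ ζ : Fin K → 𝕂, G *ᵥ ζ = 0 → ζ = 0 := by
  unfold IsGenerator
  rw [Fintype.linearIndependent_iff]
  constructor
  · intro h ζ hζ
    rw [mulVec_eq_sum_op_smul_col] at hζ
    ext k
    simpa using h _ hζ k
  · intro h g hg k
    have := h (fun k => (g k).unop) (by rw [mulVec_eq_sum_op_smul_col]; simpa using hg)
    simpa using congrFun this k

theorem euclNorm_nonneg (v : Fin N → 𝕂) : 0 ≤ euclNorm v := Real.sqrt_nonneg _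

theorem euclNorm_sq (v : Fin N → 𝕂) : euclNorm v ^ 2 = ∑ i, ‖v i‖ ^ 2 :=
  Real.sq_sqrt (Finset.sum_nonneg fun _ _ => sq_nonneg _)

instance finite_mulOpposite_pi : Module.Finite 𝕂ᵐᵒᵖ (Fin N → 𝕂) :=
  have : Module.Finite 𝕂ᵐᵒᵖ 𝕂 :=
    ⟨⟨{1}, Submodule.eq_top_iff'.2 fun x => by
      have : MulOpposite.op x • (1 : 𝕂) ∈ Submodule.span 𝕂ᵐᵒᵖ {(1 : 𝕂)} :=
        Submodule.smul_mem _ _ (Submodule.mem_span_singleton_self 1)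
      simpa using this⟩⟩
  inferInstance

theorem finrank_span_mono {s t : Set (Fin N → 𝕂)} (h : s ⊆ t) :
    Module.finrank 𝕂ᵐᵒᵖ (Submodule.span 𝕂ᵐᵒᵖ s) ≤
      Module.finrank 𝕂ᵐᵒᵖ (Submodule.span 𝕂ᵐᵒᵖ t) :=
  Submodule.finrank_mono (Submodule.span_mono h)

variable {I : Set 𝕂} {G : Matrix (Fin N) (Fin K) 𝕂}

/-- The radii in the definition of a successive minimum are nonnegative. -/
theorem nonneg_of_le_finrank_span {k : ℕ} (hk : 1 ≤ k) {r : ℝ}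
    (hr : k ≤ Module.finrank 𝕂ᵐᵒᵖ
      (Submodule.span 𝕂ᵐᵒᵖ (latticePoints I G ∩ {v | euclNorm v ≤ r}))) : 0 ≤ r := by
  by_contra! h
  have : latticePoints I G ∩ {v | euclNorm v ≤ r} = ∅ :=
    Set.eq_empty_of_forall_notMem fun v hv => (h.trans_le (euclNorm_nonneg v)).not_ge hv.2
  rw [this, Submodule.span_empty, finrank_bot] at hr
  omega

theorem bddBelow_succMin {k : ℕ} (hk : 1 ≤ k) :
    BddBelow {r : ℝ | k ≤ Module.finrank 𝕂ᵐᵒᵖ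
      (Submodule.span 𝕂ᵐᵒᵖ (latticePoints I G ∩ {v | euclNorm v ≤ r}))} :=
  ⟨0, fun _ hr => nonneg_of_le_finrank_span hk hr⟩

theorem succMin_nonneg {k : ℕ} (hk : 1 ≤ k) : 0 ≤ succMin I G k :=
  Real.sInf_nonneg fun _ hr => nonneg_of_le_finrank_span hk hr

/-- Up to the rank, the infimum defining a successive minimum is taken over a nonempty set: a ball
that contains the columns of the generator matrix qualifies. -/
theorem nonempty_succMin (h0 : (0 : 𝕂) ∈ I) (h1 : (1 : 𝕂) ∈ I) (hG : IsGenerator G) {k : ℕ}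
    (hk : k ≤ K) :
    {r : ℝ | k ≤ Module.finrank 𝕂ᵐᵒᵖ
      (Submodule.span 𝕂ᵐᵒᵖ (latticePoints I G ∩ {v | euclNorm v ≤ r}))}.Nonempty := by
  refine ⟨∑ k, euclNorm (G.col k), ?_⟩
  have h := finrank_span_eq_card hG
  rw [Fintype.card_fin] at h
  refine hk.trans (h.symm.le.trans (finrank_span_mono ?_))
  rintro _ ⟨j, rfl⟩
  refine ⟨⟨Pi.single j 1, fun i => ?_, by simp⟩, ?_⟩
  · by_cases hij : i = j
    · subst hij; simpa using h1
    · simpa [hij] using h0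
  · exact Finset.single_le_sum (f := fun k => euclNorm (G.col k))
      (fun _ _ => euclNorm_nonneg _) (Finset.mem_univ j)

theorem succMin_mono (h0 : (0 : 𝕂) ∈ I) (h1 : (1 : 𝕂) ∈ I) (hG : IsGenerator G) {k l : ℕ}
    (hk : 1 ≤ k) (hkl : k ≤ l) (hl : l ≤ K) : succMin I G k ≤ succMin I G l :=
  csInf_le_csInf (bddBelow_succMin hk) (nonempty_succMin h0 h1 hG hl)
    fun _ hr => le_trans hkl hr

theorem succMin_one_le {x : Fin N → 𝕂} (hx : x ∈ latticePoints I G) (hx0 : x ≠ 0) {r : ℝ}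
    (hr : euclNorm x ≤ r) : succMin I G 1 ≤ r := by
  refine csInf_le (bddBelow_succMin le_rfl) ?_
  have : Module.finrank 𝕂ᵐᵒᵖ (Submodule.span 𝕂ᵐᵒᵖ {x}) = 1 := finrank_span_singleton hx0
  exact this.symm.le.trans (finrank_span_mono (by simpa using ⟨hx, hr⟩))

theorem le_succMin_one (h0 : (0 : 𝕂) ∈ I) (h1 : (1 : 𝕂) ∈ I) (hG : IsGenerator G) (hK : 1 ≤ K)
    {c : ℝ} (hc : ∀ x ∈ latticePoints I G, x ≠ 0 → c ≤ euclNorm x) : c ≤ succMin I G 1 := by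
  refine le_csInf (nonempty_succMin h0 h1 hG hK) fun r hr => ?_
  by_contra! h
  have : Submodule.span 𝕂ᵐᵒᵖ (latticePoints I G ∩ {v | euclNorm v ≤ r}) = ⊥ := by
    rw [Submodule.span_eq_bot]
    rintro x ⟨hx, hxr⟩
    by_contra hx0
    exact absurd ((hc x hx hx0).trans hxr) h.not_ge
  rw [Set.mem_ofPred_eq, this, finrank_bot] at hr
  omega

/-- The lattice points that are strictly shorter than the `k`-th successive minimum span a space of
dimension less than `k`. -/
theorem finrank_span_lt_succMin {k : ℕ} (hk : 1 ≤ k) :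
    Module.finrank 𝕂ᵐᵒᵖ
      (Submodule.span 𝕂ᵐᵒᵖ (latticePoints I G ∩ {v | euclNorm v < succMin I G k})) < k := by
  by_contra! h
  obtain ⟨f, hf, hspan, -⟩ := Submodule.exists_fun_fin_finrank_span_eq 𝕂ᵐᵒᵖ
    (latticePoints I G ∩ {v | euclNorm v < succMin I G k})
  have : Nonempty (Fin (Module.finrank 𝕂ᵐᵒᵖ (Submodule.span 𝕂ᵐᵒᵖ
      (latticePoints I G ∩ {v | euclNorm v < succMin I G k})))) := ⟨⟨0, by omega⟩⟩
  obtain ⟨i, hi⟩ := Finite.exists_max fun i => euclNorm (f i)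
  refine absurd (csInf_le (bddBelow_succMin hk) (a := euclNorm (f i)) ?_) (hf i).2.not_ge
  refine h.trans ?_
  rw [← hspan]
  refine finrank_span_mono ?_
  rintro _ ⟨j, rfl⟩
  exact ⟨(hf j).1, hi j⟩

end DivisionRing

/-! ### Hermite's constant -/

section Real

variable {n : ℕ}

theorem isGenerator_real_iff (A : Matrix (Fin n) (Fin n) ℝ) : IsGenerator A ↔ A.det ≠ 0 := by
  rw [isGenerator_iff, ne_eq, ← Matrix.exists_mulVec_eq_zero_iff]
  push Not
  exact forall_congr' fun v => by tauto

theorem vol_real (A : Matrix (Fin n) (Fin n) ℝ) : vol A = |A.det| := by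
  have : HermitianDet.hdet (Aᴴ * A) = A.det ^ 2 := by
    change (Aᴴ * A).det = _
    rw [Matrix.det_mul, Matrix.det_conjTranspose, star_trivial, sq]
  rw [vol, this, Real.sqrt_sq_eq_abs]

theorem mem_latticePoints_int_iff (A : Matrix (Fin n) (Fin n) ℝ) (x : Fin n → ℝ) :
    x ∈ latticePoints (Set.range ((↑) : ℤ → ℝ)) A ↔
      ∃ z : Fin n → ℤ, x = A *ᵥ fun i => (z i : ℝ) := by
  constructor
  · rintro ⟨ζ, hζ, rfl⟩
    choose z hz using hζ
    exact ⟨z, by simp only [hz]⟩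
  · rintro ⟨z, rfl⟩
    exact ⟨_, fun k => ⟨z k, rfl⟩, rfl⟩

/-- Minkowski's first theorem for cubes. -/
theorem exists_lattice_point_abs_le (hn : n ≠ 0) {A : Matrix (Fin n) (Fin n) ℝ} (hA : A.det ≠ 0) :
    ∃ z : Fin n → ℤ, z ≠ 0 ∧
      ∀ i, |(A *ᵥ fun j => (z j : ℝ)) i| ≤ |A.det| ^ ((1 : ℝ) / n) := by
  have : NeZero n := ⟨hn⟩
  have hinv : IsUnit Aᵀ := by
    rw [Matrix.isUnit_iff_isUnit_det, Matrix.det_transpose]; exact hA.isUnit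
  have hli : LinearIndependent ℝ A.col := Matrix.linearIndependent_rows_of_isUnit hinv
  let b := basisOfLinearIndependentOfCardEqFinrank hli (by simp)
  have hb : ⇑b = A.col := coe_basisOfLinearIndependentOfCardEqFinrank _ _
  set r : ℝ := |A.det| ^ ((1 : ℝ) / n) with hr
  have hr0 : 0 ≤ r := by positivity
  let L : AddSubgroup (Fin n → ℝ) := (Submodule.span ℤ (Set.range b)).toAddSubgroup
  have : Countable L := inferInstanceAs (Countable (Submodule.span ℤ (Set.range b)))
  have : DiscreteTopology L :=
    inferInstanceAs (DiscreteTopology (Submodule.span ℤ (Set.range b)))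
  have hfund := ZSpan.isAddFundamentalDomain' b
    (MeasureTheory.volume : MeasureTheory.Measure (Fin n → ℝ))
  obtain ⟨⟨x, hxL⟩, hx0, hx⟩ :=
    MeasureTheory.exists_ne_zero_mem_lattice_of_measure_mul_two_pow_le_measure (L := L)
      (s := Set.Icc (fun _ => -r) (fun _ => r)) hfund
      (fun x hx => ⟨fun i => by simpa using hx.2 i, fun i => by
        have := hx.1 i; simp only [Pi.neg_apply]; linarith⟩)
      (convex_Icc _ _) isCompact_Icc (by
        have h2 : r ^ n = |A.det| := by
          rw [hr, ← Real.rpow_natCast, ← Real.rpow_mul (abs_nonneg _),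
            one_div_mul_cancel (by exact_mod_cast hn), Real.rpow_one]
        rw [ZSpan.volume_fundamentalDomain, Real.volume_Icc_pi, hb]
        have h3 : (Matrix.of A.col).det = A.det := by
          rw [← Matrix.det_transpose]; rfl
        have h4 : r - -r = r * 2 := by ring
        simp only [h3, h4, Finset.prod_const, Finset.card_univ, Fintype.card_fin]
        rw [← ENNReal.ofReal_pow (by positivity), mul_pow, h2,
          ENNReal.ofReal_mul (abs_nonneg _), Module.finrank_fin_fun]
        simp)
  have hxL' : x ∈ Submodule.span ℤ (Set.range b) := hxL
  obtain ⟨z, hz⟩ := (Submodule.mem_span_range_iff_exists_fun ℤ).1 hxL'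
  have hxz : x = A *ᵥ fun j => (z j : ℝ) := by
    rw [← hz, hb]
    ext i
    simp [Matrix.mulVec, dotProduct, Matrix.col, mul_comm]
  refine ⟨z, ?_, fun i => ?_⟩
  · rintro rfl
    apply hx0
    ext1
    simp [hxz, ← Pi.zero_def]
  · rw [← hxz, abs_le]
    exact ⟨hx.1 i, hx.2 i⟩

/-- The supremum defining Hermite's constant is over a bounded set, with bound `n`. -/
theorem bddAbove_hermiteConst (hn : n ≠ 0) :
    BddAbove {x : ℝ | ∃ A : Matrix (Fin n) (Fin n) ℝ, IsGenerator A ∧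
      x = succMin (Set.range ((↑) : ℤ → ℝ)) A 1 ^ 2 / vol A ^ ((2 : ℝ) / n)} := by
  refine ⟨n, ?_⟩
  rintro _ ⟨A, hA, rfl⟩
  have hA' := (isGenerator_real_iff A).1 hA
  obtain ⟨z, hz0, hz⟩ := exists_lattice_point_abs_le hn hA'
  have hd : 0 < |A.det| := abs_pos.2 hA'
  rw [vol_real, div_le_iff₀ (by positivity)]
  have hx0 : (A *ᵥ fun j => (z j : ℝ)) ≠ 0 := fun h => hz0 <| by
    have := (isGenerator_iff A).1 hA _ h
    ext j
    simpa using congrFun this j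
  have h1 := succMin_one_le ((mem_latticePoints_int_iff A _).2 ⟨z, rfl⟩) hx0 le_rfl
  calc _ ≤ euclNorm (A *ᵥ fun j => (z j : ℝ)) ^ 2 :=
        pow_le_pow_left₀ (succMin_nonneg le_rfl) h1 2
    _ ≤ ∑ _i : Fin n, (|A.det| ^ ((1 : ℝ) / n)) ^ 2 := by
        rw [euclNorm_sq]
        refine Finset.sum_le_sum fun i _ => pow_le_pow_left₀ (norm_nonneg _) (hz i) 2
    _ = n * |A.det| ^ ((2 : ℝ) / n) := by
        rw [← Real.rpow_natCast, ← Real.rpow_mul (abs_nonneg _)]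
        simp only [Finset.sum_const, Finset.card_univ, Fintype.card_fin, nsmul_eq_mul]
        congr 2
        push_cast
        ring

theorem hermiteConst_nonneg (n : ℕ) : 0 ≤ hermiteConst n := by
  refine Real.sSup_nonneg ?_
  rintro _ ⟨A, -, rfl⟩
  have : 0 ≤ vol A := Real.sqrt_nonneg _
  positivity

/-- Hermite's inequality for a lattice in which every nonzero vector has length at least one. -/
theorem one_le_hermiteConst_mul (hn : n ≠ 0) {A : Matrix (Fin n) (Fin n) ℝ} (hA : A.det ≠ 0)
    (h : ∀ z : Fin n → ℤ, z ≠ 0 → 1 ≤ ∑ i, (A *ᵥ fun j => (z j : ℝ)) i ^ 2) :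
    1 ≤ hermiteConst n * |A.det| ^ ((2 : ℝ) / n) := by
  have hd : 0 < |A.det| := abs_pos.2 hA
  have hG := (isGenerator_real_iff A).2 hA
  have h1 : 1 ≤ succMin (Set.range ((↑) : ℤ → ℝ)) A 1 := by
    refine le_succMin_one (Set.mem_range.2 ⟨0, by simp⟩)
      (Set.mem_range.2 ⟨1, by simp⟩) hG (Nat.one_le_iff_ne_zero.2 hn) ?_
    intro x hx hx0
    obtain ⟨z, rfl⟩ := (mem_latticePoints_int_iff A x).1 hx
    rw [euclNorm, Real.one_le_sqrt]
    simpa using h z (by rintro rfl; exact hx0 (by simp [← Pi.zero_def]))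
  have h2 := le_csSup (bddAbove_hermiteConst hn) ⟨A, hG, rfl⟩
  rw [vol_real, div_le_iff₀ (by positivity)] at h2
  exact (one_le_pow₀ h1).trans h2

end Real

/-! ### Minkowski's second theorem for real lattices -/

section Euclidean

open scoped RealInnerProductSpace

variable {E : Type*} [NormedAddCommGroup E] [InnerProductSpace ℝ E] {n : ℕ}

/-- A space `S` of dimension `n` with a chain of subspaces `F i`, each of dimension at most `i`, has
an orthonormal basis adapted to the chain: `e j` is orthogonal to `F i` whenever `i ≤ j`. The last
vector is chosen orthogonal to the largest subspace, then one passes to its orthogonal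
complement. -/
theorem exists_orthonormal_orthogonal_chain (S : Submodule ℝ E) [FiniteDimensional ℝ S]
    (hS : Module.finrank ℝ S = n) (F : Fin n → Submodule ℝ E) (hF : Monotone F)
    (hFS : ∀ i, F i ≤ S) (hdim : ∀ i, Module.finrank ℝ (F i) ≤ i) :
    ∃ e : Fin n → E, Orthonormal ℝ e ∧ (∀ i, e i ∈ S) ∧
      ∀ i j, i ≤ j → ∀ x ∈ F i, ⟪e j, x⟫ = 0 := by
  induction n generalizing S with
  | zero => exact ⟨Fin.elim0, ⟨fun i => i.elim0, fun i => i.elim0⟩, fun i => i.elim0,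
      fun i => i.elim0⟩
  | succ n ih =>
    have h1 := Submodule.finrank_add_inf_finrank_orthogonal (hFS (Fin.last n))
    have h2 := hdim (Fin.last n)
    rw [Fin.val_last] at h2
    obtain ⟨u, hu, hu0⟩ : ∃ u ∈ (F (Fin.last n))ᗮ ⊓ S, u ≠ 0 := by
      refine Submodule.exists_mem_ne_zero_of_ne_bot fun h => ?_
      rw [h, finrank_bot] at h1
      omega
    have hspan : Submodule.span ℝ {u} ≤ S := by
      rw [Submodule.span_singleton_le_iff_mem]; exact hu.2
    have h3 := Submodule.finrank_add_inf_finrank_orthogonal hspan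
    rw [finrank_span_singleton hu0, hS] at h3
    have : FiniteDimensional ℝ ↥((Submodule.span ℝ {u})ᗮ ⊓ S) :=
      Submodule.finiteDimensional_of_le inf_le_right
    have hlast : F (Fin.last n) ≤ (Submodule.span ℝ {u})ᗮ ⊓ S := by
      refine le_inf (fun x hx => ?_) (hFS _)
      rw [Submodule.mem_orthogonal_singleton_iff_inner_right]
      exact Submodule.inner_left_of_mem_orthogonal hx hu.1
    obtain ⟨e, he, heS, heF⟩ := ih _ (by omega) (fun i => F i.castSucc)
      (fun i j hij => hF (by simpa using hij)) (fun i => (hF (Fin.le_last _)).trans hlast)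
      (fun i => by simpa using hdim i.castSucc)
    have hun : ‖u‖ ≠ 0 := norm_ne_zero_iff.2 hu0
    have hue : ∀ i, ⟪u, e i⟫ = 0 := fun i =>
      (Submodule.mem_orthogonal_singleton_iff_inner_right).1 (heS i).1
    refine ⟨Fin.snoc (α := fun _ => E) e (‖u‖⁻¹ • u), ⟨fun i => ?_, fun i j hij => ?_⟩,
      fun i => ?_, fun i j hij x hx => ?_⟩
    · induction i using Fin.lastCases with
      | last => simp [norm_smul, hun]
      | cast i => simpa using he.1 i
    · induction i using Fin.lastCases with
      | last =>
        induction j using Fin.lastCases with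
        | last => exact absurd rfl hij
        | cast j => simp [inner_smul_left, hue]
      | cast i =>
        induction j using Fin.lastCases with
        | last => simp [inner_smul_right, real_inner_comm, hue]
        | cast j => simpa using he.2 (fun h => hij (by rw [h]))
    · induction i using Fin.lastCases with
      | last => simpa using S.smul_mem _ hu.2
      | cast i => simpa using (heS i).2
    · induction j using Fin.lastCases with
      | last =>
        have := Submodule.inner_left_of_mem_orthogonal (hF (Fin.le_last i) hx) hu.1
        simp [inner_smul_left, this]
      | cast j =>
        induction i using Fin.lastCases with
        | last => simp [Fin.le_iff_val_le_val] at hij; omega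
        | cast i => simpa using heF i j (by simpa using hij) x hx

theorem inner_eq_sum_of_mem_span {e : Fin n → E} (he : Orthonormal ℝ e) {x y : E}
    (hx : x ∈ Submodule.span ℝ (Set.range e)) (hy : y ∈ Submodule.span ℝ (Set.range e)) :
    ⟪x, y⟫ = ∑ i, ⟪e i, x⟫ * ⟪e i, y⟫ := by
  obtain ⟨a, rfl⟩ := (Submodule.mem_span_range_iff_exists_fun ℝ).1 hx
  obtain ⟨b, rfl⟩ := (Submodule.mem_span_range_iff_exists_fun ℝ).1 hy
  rw [he.inner_sum]
  simp [he.inner_right_fintype]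

/-- Minkowski's second theorem, with Hermite's constant, in terms of lower bounds `l i` for the
successive minima: the lattice vectors shorter than `l i` span a space of dimension at most `i`
(indices start at `0`). Dividing the `i`-th coordinate with respect to an adapted orthonormal basis
by `l i` gives a lattice without nonzero vectors of length less than one. -/
theorem prod_sq_le_hermiteConst_pow_mul_det_gram (hn : n ≠ 0) {v : Fin n → E}
    (hv : LinearIndependent ℝ v) {l : Fin n → ℝ} (hl : Monotone l) (hl0 : ∀ i, 0 < l i)
    (hdim : ∀ i, Module.finrank ℝ (Submodule.span ℝ
      {x | (∃ z : Fin n → ℤ, x = ∑ j, (z j : ℝ) • v j) ∧ ‖x‖ < l i}) ≤ i) :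
    (∏ i, l i) ^ 2 ≤ hermiteConst n ^ n * (Matrix.gram ℝ v).det := by
  set S := Submodule.span ℝ (Set.range v) with hS
  have : FiniteDimensional ℝ S := FiniteDimensional.span_of_finite ℝ (Set.finite_range v)
  have hSdim : Module.finrank ℝ S = n := by rw [hS, finrank_span_eq_card hv, Fintype.card_fin]
  have hvS : ∀ z : Fin n → ℤ, ∑ j, (z j : ℝ) • v j ∈ S := fun z =>
    S.sum_mem fun j _ => S.smul_mem _ (Submodule.subset_span ⟨j, rfl⟩)
  obtain ⟨e, he, heS, heF⟩ := exists_orthonormal_orthogonal_chain S hSdim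
    (fun i => Submodule.span ℝ {x | (∃ z : Fin n → ℤ, x = ∑ j, (z j : ℝ) • v j) ∧ ‖x‖ < l i})
    (fun i j hij => Submodule.span_mono fun x hx => ⟨hx.1, hx.2.trans_le (hl hij)⟩)
    (fun i => Submodule.span_le.2 fun x hx => by obtain ⟨z, rfl⟩ := hx.1; exact hvS z) hdim
  have hspan : Submodule.span ℝ (Set.range e) = S := by
    refine Submodule.eq_of_le_of_finrank_eq (Submodule.span_le.2 ?_) ?_
    · rintro _ ⟨i, rfl⟩; exact heS i
    · rw [finrank_span_eq_card he.linearIndependent, Fintype.card_fin, hSdim]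
  have hve : ∀ j, v j ∈ Submodule.span ℝ (Set.range e) := fun j => by
    rw [hspan]; exact Submodule.subset_span ⟨j, rfl⟩
  let M : Matrix (Fin n) (Fin n) ℝ := Matrix.of fun i j => ⟪e i, v j⟫
  have hgram : Matrix.gram ℝ v = Mᵀ * M := by
    ext i j
    rw [Matrix.gram_apply, inner_eq_sum_of_mem_span he (hve i) (hve j)]
    rfl
  have hdet : (Matrix.gram ℝ v).det = M.det ^ 2 := by
    rw [hgram, Matrix.det_mul, Matrix.det_transpose, sq]
  have hM : M.det ≠ 0 := by
    have := Matrix.det_gram_ne_zero_iff_linearIndependent.2 hv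
    rw [hdet] at this
    exact fun h => this (by rw [h]; norm_num)
  have hP : 0 < ∏ i, l i := Finset.prod_pos fun i _ => hl0 i
  have hA : (Matrix.diagonal (fun i => (l i)⁻¹) * M).det = (∏ i, l i)⁻¹ * M.det := by
    rw [Matrix.det_mul, Matrix.det_diagonal, Finset.prod_inv_distrib]
  have key := one_le_hermiteConst_mul hn (A := Matrix.diagonal (fun i => (l i)⁻¹) * M)
    (by rw [hA]; exact mul_ne_zero (inv_ne_zero hP.ne') hM) (by
      intro z hz
      set x := ∑ j, (z j : ℝ) • v j with hx
      have hx0 : x ≠ 0 := fun h => hz <| by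
        have := Fintype.linearIndependent_iff.1 hv _ h
        ext j
        simpa using this j
      have hxe : x ∈ Submodule.span ℝ (Set.range e) := by rw [hspan]; exact hvS z
      have hnorm : ‖x‖ ^ 2 = ∑ i, ⟪e i, x⟫ ^ 2 := by
        rw [← real_inner_self_eq_norm_sq, inner_eq_sum_of_mem_span he hxe hxe]
        simp only [sq]
      have hcoord : ∀ i, ((Matrix.diagonal (fun i => (l i)⁻¹) * M) *ᵥ fun j => (z j : ℝ)) i =
          (l i)⁻¹ * ⟪e i, x⟫ := by
        intro i
        rw [← Matrix.mulVec_mulVec, Matrix.mulVec_diagonal, hx, inner_sum]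
        simp [Matrix.mulVec, dotProduct, M, inner_smul_right, mul_comm]
      simp only [hcoord]
      -- The last nonvanishing coordinate of `x` shows which of the bounds applies to `x`.
      obtain ⟨i, hi, hmax⟩ : ∃ i, ⟪e i, x⟫ ≠ 0 ∧ ∀ j, i < j → ⟪e j, x⟫ = 0 := by
        have hne : (Finset.univ.filter fun i => ⟪e i, x⟫ ≠ 0).Nonempty := by
          by_contra h
          rw [Finset.not_nonempty_iff_eq_empty, Finset.filter_eq_empty_iff] at h
          push Not at h
          apply hx0
          rw [← norm_eq_zero, ← sq_eq_zero_iff, hnorm]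
          exact Finset.sum_eq_zero fun i hi => by rw [h hi]; norm_num
        refine ⟨_, (Finset.mem_filter.1 (Finset.max'_mem _ hne)).2, fun j hj => ?_⟩
        by_contra h
        exact absurd (Finset.le_max' _ j (by simpa using h)) hj.not_ge
      have hli : l i ≤ ‖x‖ := by
        by_contra! h
        exact hi (heF i i le_rfl x (Submodule.subset_span ⟨⟨z, rfl⟩, h⟩))
      calc (1 : ℝ) ≤ (l i)⁻¹ ^ 2 * ‖x‖ ^ 2 := by
            rw [← mul_pow]
            refine one_le_pow₀ ?_
            rw [inv_mul_eq_div, one_le_div (hl0 i)]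
            exact hli
        _ = ∑ j, (l i)⁻¹ ^ 2 * ⟪e j, x⟫ ^ 2 := by rw [hnorm, Finset.mul_sum]
        _ ≤ ∑ j, ((l j)⁻¹ * ⟪e j, x⟫) ^ 2 := by
            refine Finset.sum_le_sum fun j _ => ?_
            rcases lt_or_ge i j with hij | hij
            · rw [hmax j hij]; simp
            · rw [mul_pow]
              have := inv_anti₀ (hl0 j) (hl hij)
              have := inv_pos.2 (hl0 i)
              gcongr)
  rw [hA] at key
  have key' := one_le_pow₀ key (n := n)
  rw [mul_pow, ← Real.rpow_natCast (_ ^ (2 / (n : ℝ))), ← Real.rpow_mul (abs_nonneg _),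
    div_mul_cancel₀ _ (by exact_mod_cast hn), Real.rpow_two, sq_abs, mul_pow, inv_pow,
    ← hdet] at key'
  calc (∏ i, l i) ^ 2 ≤ (∏ i, l i) ^ 2 *
        (hermiteConst n ^ n * (((∏ i, l i) ^ 2)⁻¹ * (Matrix.gram ℝ v).det)) :=
        le_mul_of_one_le_right (by positivity) key'
    _ = hermiteConst n ^ n * (Matrix.gram ℝ v).det := by
        field_simp

/-- The Gram determinant does not decrease when passing to a sublattice of full rank: it is
multiplied by the square of a nonzero integer. -/
theorem det_gram_le_of_sublattice {ι : Type*} [Fintype ι] [DecidableEq ι] {v w : ι → E}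
    (hw : LinearIndependent ℝ w) (h : ∀ j, ∃ z : ι → ℤ, w j = ∑ i, (z i : ℝ) • v i) :
    (Matrix.gram ℝ v).det ≤ (Matrix.gram ℝ w).det := by
  choose z hz using h
  let Z : Matrix ι ι ℤ := Matrix.of fun j i => z j i
  have hgram : Matrix.gram ℝ w =
      Z.map (Int.cast : ℤ → ℝ) * Matrix.gram ℝ v * (Z.map (Int.cast : ℤ → ℝ))ᵀ := by
    ext j k
    simp only [Matrix.gram_apply, hz, sum_inner, inner_sum, Matrix.mul_apply, Finset.sum_mul,
      inner_smul_left, inner_smul_right]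
    simp only [Finset.mul_sum]
    refine Finset.sum_congr rfl fun a _ => Finset.sum_congr rfl fun b _ => ?_
    simp only [Z, Matrix.map_apply, Matrix.of_apply, Matrix.transpose_apply,
      RCLike.conj_to_real, real_inner_comm]
    ring
  have hdet : (Matrix.gram ℝ w).det = ((Z.det ^ 2 : ℤ) : ℝ) * (Matrix.gram ℝ v).det := by
    have : (Z.map (Int.cast : ℤ → ℝ)).det = (Z.det : ℝ) :=
      ((Int.castRingHom ℝ).map_det Z).symm
    rw [hgram, Matrix.det_mul, Matrix.det_mul, Matrix.det_transpose, this]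
    push_cast
    ring
  have hZ : Z.det ≠ 0 := fun h0 => by
    have := Matrix.det_gram_ne_zero_iff_linearIndependent.2 hw
    exact this (by rw [hdet, h0]; simp)
  have h1 : (1 : ℝ) ≤ ((Z.det ^ 2 : ℤ) : ℝ) := by exact_mod_cast sq_pos_of_ne_zero hZ
  rw [hdet]
  exact le_mul_of_one_le_left (Matrix.posSemidef_gram ℝ v).det_nonneg h1

end Euclidean

/-! ### Passing from `𝕂` to `ℝ` -/

/-- Left multiplication by a matrix over `𝕂` as a real linear map. -/
def realMulVec {𝕂 : Type} [NormedDivisionRing 𝕂] [Algebra ℝ 𝕂] {m n : ℕ}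
    (A : Matrix (Fin m) (Fin n) 𝕂) : (Fin n → 𝕂) →ₗ[ℝ] (Fin m → 𝕂) where
  toFun ζ := A *ᵥ ζ
  map_add' := Matrix.mulVec_add A
  map_smul' c ζ := Matrix.mulVec_smul A c ζ

/-- Real coordinates on scalars `𝕂` with `D` real components, for which `I` is the lattice in `ℝ^D`
with generator matrix `B` and closed under multiplication. The coordinates are isometric, left
multiplications by `c` and `star c` are adjoint, and the `D`-th power of `hdet` is the real
determinant on Gram matrices. -/
structure RealModel {𝕂 : Type} [NormedDivisionRing 𝕂] [StarRing 𝕂] [HermitianDet 𝕂] [Algebra ℝ 𝕂]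
    (I : Set 𝕂) {D : ℕ} (B : Matrix (Fin D) (Fin D) ℝ) where
  /-- The real coordinates of a scalar. -/
  coord : 𝕂 ≃ₗ[ℝ] (Fin D → ℝ)
  pos : D ≠ 0
  det_ne_zero : B.det ≠ 0
  sum_coord_sq : ∀ x, ∑ a, coord x a ^ 2 = ‖x‖ ^ 2
  coord_mul_dotProduct : ∀ c x y, coord (c * x) ⬝ᵥ coord y = coord x ⬝ᵥ coord (star c * y)
  mem_iff : ∀ x, x ∈ I ↔ ∃ z : Fin D → ℤ, coord x = B *ᵥ fun a => (z a : ℝ)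
  one_mem : 1 ∈ I
  mul_mem : ∀ x ∈ I, ∀ y ∈ I, x * y ∈ I
  hdet_nonneg : ∀ {N K : ℕ} (G : Matrix (Fin N) (Fin K) 𝕂), 0 ≤ HermitianDet.hdet (Gᴴ * G)
  hdet_pow : ∀ {N K : ℕ} (G : Matrix (Fin N) (Fin K) 𝕂),
    HermitianDet.hdet (Gᴴ * G) ^ D = LinearMap.det (realMulVec (Gᴴ * G))

namespace RealModel

variable {𝕂 : Type} [NormedDivisionRing 𝕂] [StarRing 𝕂] [HermitianDet 𝕂] [Algebra ℝ 𝕂]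
  {I : Set 𝕂} {D : ℕ} {B : Matrix (Fin D) (Fin D) ℝ} (M : RealModel I B) {N K : ℕ}

/-- The real coordinates of a vector over `𝕂`. -/
def vecCoord (N : ℕ) : (Fin N → 𝕂) ≃ₗ[ℝ] (Fin D × Fin N → ℝ) where
  toFun x p := M.coord (x p.2) p.1
  map_add' x y := by ext; simp
  map_smul' c x := by ext; simp
  invFun y i := M.coord.symm fun a => y (a, i)
  left_inv x := by ext; simp
  right_inv y := by ext; simp

theorem vecCoord_apply (x : Fin N → 𝕂) (a : Fin D) (i : Fin N) :
    M.vecCoord N x (a, i) = M.coord (x i) a := rfl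

theorem sum_vecCoord_sq (x : Fin N → 𝕂) : ∑ p, M.vecCoord N x p ^ 2 = euclNorm x ^ 2 := by
  rw [euclNorm_sq, Fintype.sum_prod_type_right]
  exact Finset.sum_congr rfl fun i _ => M.sum_coord_sq (x i)

/-- The real coordinates of a vector over `𝕂`, as a point of Euclidean space. -/
def toEuclidean (N : ℕ) : (Fin N → 𝕂) ≃ₗ[ℝ] EuclideanSpace ℝ (Fin D × Fin N) :=
  M.vecCoord N ≪≫ₗ (WithLp.linearEquiv 2 ℝ (Fin D × Fin N → ℝ)).symm

theorem toEuclidean_apply (x : Fin N → 𝕂) (p : Fin D × Fin N) :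
    M.toEuclidean N x p = M.vecCoord N x p := rfl

theorem norm_toEuclidean (x : Fin N → 𝕂) : ‖M.toEuclidean N x‖ = euclNorm x := by
  rw [EuclideanSpace.norm_eq, ← Real.sqrt_sq (euclNorm_nonneg x), ← M.sum_vecCoord_sq]
  simp only [Real.norm_eq_abs, sq_abs]
  rfl

/-- The real matrix that describes left multiplication by a matrix over `𝕂`. -/
def realMatrix (A : Matrix (Fin N) (Fin K) 𝕂) : Matrix (Fin D × Fin N) (Fin D × Fin K) ℝ :=
  Matrix.of fun p q => M.coord (A p.2 q.2 * M.coord.symm (Pi.single q.1 1)) p.1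

theorem vecCoord_mulVec (A : Matrix (Fin N) (Fin K) 𝕂) (ζ : Fin K → 𝕂) :
    M.vecCoord N (A *ᵥ ζ) = M.realMatrix A *ᵥ M.vecCoord K ζ := by
  ext ⟨a, i⟩
  have h : ∀ x : 𝕂, x = ∑ c, M.coord x c • M.coord.symm (Pi.single c 1) := fun x => by
    apply M.coord.injective
    simp only [map_sum, map_smul, LinearEquiv.apply_symm_apply]
    exact pi_eq_sum_univ' _
  have h2 : ∀ g x : 𝕂, M.coord (g * x) a =
      ∑ c, M.coord (g * M.coord.symm (Pi.single c 1)) a * M.coord x c := fun g x => by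
    conv_lhs => rw [h x]
    simp [Finset.mul_sum, mul_comm]
  rw [vecCoord_apply, Matrix.mulVec, dotProduct, map_sum, Finset.sum_apply, Matrix.mulVec,
    dotProduct, Fintype.sum_prod_type_right]
  exact Finset.sum_congr rfl fun k _ => h2 _ _

theorem realMatrix_conjTranspose (A : Matrix (Fin N) (Fin K) 𝕂) :
    M.realMatrix Aᴴ = (M.realMatrix A)ᵀ := by
  ext ⟨a, i⟩ ⟨c, k⟩
  have := M.coord_mul_dotProduct (A k i) (M.coord.symm (Pi.single a 1))
    (M.coord.symm (Pi.single c 1))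
  simpa [realMatrix] using this.symm

theorem realMatrix_mul {m : ℕ} (A : Matrix (Fin m) (Fin N) 𝕂) (C : Matrix (Fin N) (Fin K) 𝕂) :
    M.realMatrix (A * C) = M.realMatrix A * M.realMatrix C := by
  refine Matrix.ext_of_mulVec_single fun q => ?_
  obtain ⟨ζ, hζ⟩ := (M.vecCoord K).surjective (Pi.single q 1)
  rw [← hζ, ← vecCoord_mulVec, ← Matrix.mulVec_mulVec, ← Matrix.mulVec_mulVec, vecCoord_mulVec,
    vecCoord_mulVec]

theorem det_realMatrix (A : Matrix (Fin K) (Fin K) 𝕂) :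
    (M.realMatrix A).det = LinearMap.det (realMulVec A) := by
  rw [← LinearMap.det_conj (realMulVec A) (M.vecCoord K), ← LinearMap.det_toLin']
  congr 1
  refine LinearMap.ext fun y => ?_
  obtain ⟨ζ, rfl⟩ := (M.vecCoord K).surjective y
  simp only [LinearMap.comp_apply, LinearEquiv.coe_coe, LinearEquiv.symm_apply_apply,
    Matrix.toLin'_apply, ← vecCoord_mulVec]
  rfl

/-- A `ℤ`-basis of `I^K`: its real coordinates are the columns of `B ⊗ₖ 1`. -/
def intBasis (K : ℕ) (q : Fin D × Fin K) : Fin K → 𝕂 :=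
  (M.vecCoord K).symm ((B ⊗ₖ (1 : Matrix (Fin K) (Fin K) ℝ)).col q)

theorem forall_mem_iff (ζ : Fin K → 𝕂) :
    (∀ k, ζ k ∈ I) ↔ ∃ z : Fin D × Fin K → ℤ, ζ = ∑ q, (z q : ℝ) • M.intBasis K q := by
  have key : ∀ (z : Fin D × Fin K → ℤ) (a : Fin D) (k : Fin K),
      M.vecCoord K (∑ q, (z q : ℝ) • M.intBasis K q) (a, k) =
        (B *ᵥ fun c => (z (c, k) : ℝ)) a := by
    intro z a k
    simp [intBasis, Fintype.sum_prod_type, Matrix.col, Matrix.mulVec, dotProduct,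
      Matrix.one_apply, mul_comm]
  constructor
  · intro h
    choose z hz using fun k => (M.mem_iff _).1 (h k)
    refine ⟨fun q => z q.2 q.1, (M.vecCoord K).injective ?_⟩
    ext ⟨a, k⟩
    rw [key, vecCoord_apply, hz]
  · rintro ⟨z, rfl⟩ k
    refine (M.mem_iff _).2 ⟨fun c => z (c, k), ?_⟩
    ext a
    rw [← key z a k]
    rfl

theorem zero_mem (M : RealModel I B) : (0 : 𝕂) ∈ I :=
  (M.mem_iff 0).2 ⟨0, by ext; simp [Matrix.mulVec, dotProduct]⟩

theorem intBasis_mem (q : Fin D × Fin K) (k : Fin K) : M.intBasis K q k ∈ I :=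
  (M.forall_mem_iff _).2 ⟨Pi.single q 1, by
    simp [Pi.single_apply, ite_smul]⟩ k

/-- A `ℤ`-basis of the lattice generated by `G` over `I`, in real coordinates. -/
def latticeBasis (G : Matrix (Fin N) (Fin K) 𝕂) (q : Fin D × Fin K) :
    EuclideanSpace ℝ (Fin D × Fin N) :=
  M.toEuclidean N (G *ᵥ M.intBasis K q)

theorem sum_smul_latticeBasis (G : Matrix (Fin N) (Fin K) 𝕂) (c : Fin D × Fin K → ℝ) :
    ∑ q, c q • M.latticeBasis G q = M.toEuclidean N (G *ᵥ ∑ q, c q • M.intBasis K q) := by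
  change _ = M.toEuclidean N (realMulVec G _)
  simp only [map_sum, map_smul]
  rfl

theorem mem_latticePoints_iff (G : Matrix (Fin N) (Fin K) 𝕂) (x : Fin N → 𝕂) :
    x ∈ latticePoints I G ↔
      ∃ z : Fin D × Fin K → ℤ, M.toEuclidean N x = ∑ q, (z q : ℝ) • M.latticeBasis G q := by
  constructor
  · rintro ⟨ζ, hζ, rfl⟩
    obtain ⟨z, rfl⟩ := (M.forall_mem_iff ζ).1 hζ
    exact ⟨z, (M.sum_smul_latticeBasis G _).symm⟩
  · rintro ⟨z, hz⟩
    rw [M.sum_smul_latticeBasis] at hz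
    exact ⟨_, (M.forall_mem_iff _).2 ⟨z, rfl⟩, (M.toEuclidean N).injective hz⟩

theorem det_kronecker_ne_zero (M : RealModel I B) :
    (B ⊗ₖ (1 : Matrix (Fin K) (Fin K) ℝ)).det ≠ 0 := by
  rw [Matrix.det_kronecker, Matrix.det_one, one_pow, mul_one]
  exact pow_ne_zero _ M.det_ne_zero

theorem linearIndependent_latticeBasis {G : Matrix (Fin N) (Fin K) 𝕂} (hG : IsGenerator G) :
    LinearIndependent ℝ (M.latticeBasis G) := by
  rw [Fintype.linearIndependent_iff]
  intro c hc
  rw [sum_smul_latticeBasis, LinearEquiv.map_eq_zero_iff] at hc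
  have h := congrArg (M.vecCoord K) ((isGenerator_iff G).1 hG _ hc)
  have h' : (B ⊗ₖ (1 : Matrix (Fin K) (Fin K) ℝ)) *ᵥ c = 0 := by
    rw [map_zero] at h
    rw [← h]
    ext p
    simp [intBasis, Matrix.mulVec, dotProduct, Matrix.col, mul_comm]
  by_contra! hne
  obtain ⟨i, hi⟩ := hne
  exact M.det_kronecker_ne_zero (Matrix.exists_mulVec_eq_zero_iff.1
    ⟨c, fun h0 => hi (by rw [h0]; rfl), h'⟩)

/-- The squared volume of the real lattice. The Gram matrix of its basis is that of multiplication by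
`Gᴴ * G`, expressed in the `ℤ`-basis of `I^K`. -/
theorem det_gram_latticeBasis (G : Matrix (Fin N) (Fin K) 𝕂) :
    (Matrix.gram ℝ (M.latticeBasis G)).det =
      (B ⊗ₖ (1 : Matrix (Fin K) (Fin K) ℝ)).det ^ 2 * (vol G ^ 2) ^ D := by
  have hgram : Matrix.gram ℝ (M.latticeBasis G) =
      (M.realMatrix G * (B ⊗ₖ (1 : Matrix (Fin K) (Fin K) ℝ)))ᵀ *
        (M.realMatrix G * (B ⊗ₖ (1 : Matrix (Fin K) (Fin K) ℝ))) := by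
    have hv : ∀ p q, M.latticeBasis G q p =
        (M.realMatrix G * (B ⊗ₖ (1 : Matrix (Fin K) (Fin K) ℝ))) p q := by
      intro p q
      rw [latticeBasis, toEuclidean_apply, vecCoord_mulVec, intBasis,
        LinearEquiv.apply_symm_apply]
      rfl
    ext q r
    rw [Matrix.gram_apply, PiLp.inner_apply, Matrix.mul_apply]
    refine Finset.sum_congr rfl fun p _ => ?_
    rw [Matrix.transpose_apply, ← hv, ← hv]
    simp [mul_comm]
  rw [hgram, Matrix.transpose_mul, Matrix.mul_assoc, Matrix.det_mul, ← Matrix.mul_assoc,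
    Matrix.det_mul, ← realMatrix_conjTranspose, ← realMatrix_mul, det_realMatrix, ← M.hdet_pow,
    Matrix.det_transpose, vol, Real.sq_sqrt (M.hdet_nonneg G)]
  ring

theorem vol_pos (M : RealModel I B) {G : Matrix (Fin N) (Fin K) 𝕂} (hG : IsGenerator G) : 0 < vol G := by
  refine (Real.sqrt_nonneg _).lt_of_ne fun h => ?_
  have := Matrix.det_gram_ne_zero_iff_linearIndependent.2 (M.linearIndependent_latticeBasis hG)
  rw [det_gram_latticeBasis] at this
  change 0 = vol G at h
  rw [← h] at this
  exact this (by simp [M.pos])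

/-- A sublattice of full rank has at least the volume of the lattice. -/
theorem vol_le_vol_mul (M : RealModel I B) {G : Matrix (Fin N) (Fin K) 𝕂}
    {T : Matrix (Fin K) (Fin K) 𝕂} (hT : ∀ i j, T i j ∈ I) (hGT : IsGenerator (G * T)) : vol G ≤ vol (G * T) := by
  have h := det_gram_le_of_sublattice (v := M.latticeBasis G)
    (M.linearIndependent_latticeBasis hGT) (fun q => by
      refine (M.mem_latticePoints_iff G ((G * T) *ᵥ M.intBasis K q)).1
        ⟨T *ᵥ M.intBasis K q, fun k => ?_, by rw [Matrix.mulVec_mulVec]⟩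
      have hadd : ∀ s : Finset (Fin K), ∑ j ∈ s, T k j * M.intBasis K q j ∈ I := by
        intro s
        refine Finset.sum_induction _ (· ∈ I) (fun x y hx hy => ?_) M.zero_mem
          fun j _ => M.mul_mem _ (hT k j) _ (M.intBasis_mem q j)
        obtain ⟨z, hz⟩ := (M.mem_iff x).1 hx
        obtain ⟨w, hw⟩ := (M.mem_iff y).1 hy
        refine (M.mem_iff _).2 ⟨z + w, ?_⟩
        rw [map_add, hz, hw, ← Matrix.mulVec_add]
        congr 1
        ext a
        simp
      exact hadd Finset.univ)
  have hpos : 0 < (B ⊗ₖ (1 : Matrix (Fin K) (Fin K) ℝ)).det ^ 2 :=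
    sq_pos_of_ne_zero M.det_kronecker_ne_zero
  rw [det_gram_latticeBasis, det_gram_latticeBasis] at h
  have h2 := le_of_mul_le_mul_left h hpos
  rw [← pow_mul, ← pow_mul] at h2
  exact le_of_pow_le_pow_left₀ (mul_ne_zero two_ne_zero M.pos) (Real.sqrt_nonneg _) h2

/-- A set of vectors over `𝕂` spans a real space of dimension at most `D` times the dimension of the
right `𝕂`-space it spans. -/
theorem finrank_span_image_toEuclidean_le (s : Set (Fin N → 𝕂)) :
    Module.finrank ℝ (Submodule.span ℝ (M.toEuclidean N '' s)) ≤
      D * Module.finrank 𝕂ᵐᵒᵖ (Submodule.span 𝕂ᵐᵒᵖ s) := by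
  have : Module.Finite ℝ 𝕂 := Module.Finite.equiv M.coord.symm
  have : IsScalarTower ℝ 𝕂ᵐᵒᵖ (Fin N → 𝕂) := ⟨fun r c x => by
    ext i; simp⟩
  have h1 : Module.finrank ℝ 𝕂ᵐᵒᵖ = D := by
    rw [← (MulOpposite.opLinearEquiv ℝ (M := 𝕂)).finrank_eq, M.coord.finrank_eq,
      Module.finrank_fin_fun]
  have h2 : Module.finrank ℝ 𝕂ᵐᵒᵖ * Module.finrank 𝕂ᵐᵒᵖ (Submodule.span 𝕂ᵐᵒᵖ s) =
      Module.finrank ℝ ((Submodule.span 𝕂ᵐᵒᵖ s).restrictScalars ℝ) :=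
    Module.finrank_mul_finrank ℝ 𝕂ᵐᵒᵖ (Submodule.span 𝕂ᵐᵒᵖ s)
  rw [h1] at h2
  rw [h2, ← LinearEquiv.coe_coe, ← Submodule.map_span, LinearEquiv.finrank_map_eq]
  exact Submodule.finrank_mono (Submodule.span_le.2 Submodule.subset_span)

end RealModel

/-! ### Minkowski's second theorem over `𝕂` -/

theorem prod_range_div (f : ℕ → ℝ) {D : ℕ} (hD : D ≠ 0) (K : ℕ) :
    ∏ i ∈ Finset.range (D * K), f (i / D) = (∏ k ∈ Finset.range K, f k) ^ D := by
  induction K with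
  | zero => simp
  | succ K ih =>
    rw [Nat.mul_succ, Finset.prod_range_add, ih, Finset.prod_range_succ, mul_pow]
    congr 1
    rw [Finset.prod_congr rfl (g := fun _ => f K)]
    · simp
    · intro x hx
      rw [Nat.mul_add_div (Nat.pos_of_ne_zero hD), Nat.div_eq_of_lt (Finset.mem_range.1 hx),
        add_zero]

/-- For a nondecreasing sequence, the geometric mean of an initial segment is at most the geometric
mean of the whole sequence. -/
theorem prod_pow_le_prod_pow {a : ℕ → ℝ} {L K : ℕ} (hLK : L ≤ K) (h0 : ∀ k, 0 ≤ a k)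
    (ha : ∀ k l, k ≤ l → l < K → a k ≤ a l) :
    (∏ k ∈ Finset.range L, a k) ^ K ≤ (∏ k ∈ Finset.range K, a k) ^ L := by
  obtain ⟨m, rfl⟩ := Nat.exists_eq_add_of_le hLK
  rcases m with _ | m
  · simp
  have h1 : (∏ k ∈ Finset.range L, a k) ≤ a L ^ L := by
    refine (Finset.prod_le_prod (fun _ _ => h0 _) (g := fun _ => a L) fun k hk => ?_).trans
      (by simp)
    exact ha k L (Finset.mem_range.1 hk).le (by omega)
  have h2 : a L ^ (m + 1) ≤ ∏ x ∈ Finset.range (m + 1), a (L + x) := by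
    refine le_trans (by simp) (Finset.prod_le_prod (fun _ _ => h0 L) (f := fun _ => a L)
      fun x hx => ha L (L + x) (by omega) (by have := Finset.mem_range.1 hx; omega))
  have hP : 0 ≤ ∏ k ∈ Finset.range L, a k := Finset.prod_nonneg fun k _ => h0 k
  rw [Finset.prod_range_add, pow_add, mul_pow]
  refine mul_le_mul_of_nonneg_left ?_ (pow_nonneg hP _)
  calc _ ≤ (a L ^ L) ^ (m + 1) := pow_le_pow_left₀ hP h1 _
    _ = (a L ^ (m + 1)) ^ L := by rw [← pow_mul, ← pow_mul, mul_comm]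
    _ ≤ _ := pow_le_pow_left₀ (pow_nonneg (h0 L) _) h2 _

theorem prod_Icc_one_eq_prod_range (f : ℕ → ℝ) (L : ℕ) :
    ∏ l ∈ Finset.Icc 1 L, f l = ∏ l ∈ Finset.range L, f (l + 1) := by
  induction L with
  | zero => simp
  | succ L ih => rw [Finset.prod_Icc_succ_top (by omega), ih, Finset.prod_range_succ]

namespace RealModel

variable {𝕂 : Type} [NormedDivisionRing 𝕂] [StarRing 𝕂] [HermitianDet 𝕂] [Algebra ℝ 𝕂]
  {I : Set 𝕂} {D : ℕ} {B : Matrix (Fin D) (Fin D) ℝ} {N K : ℕ}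
  {G : Matrix (Fin N) (Fin K) 𝕂}

/-- The `D`-th power of Minkowski's second theorem over `𝕂`. Each successive minimum over `𝕂` is a
lower bound for `D` consecutive successive minima of the real lattice. -/
theorem prod_succMin_pow_le (M : RealModel I B) (hK : K ≠ 0) (hG : IsGenerator G)
    (hpos : ∀ k < K, 0 < succMin I G (k + 1)) :
    ((∏ k ∈ Finset.range K, succMin I G (k + 1)) ^ D) ^ 2 ≤
      hermiteConst (D * K) ^ (D * K) *
        ((B ⊗ₖ (1 : Matrix (Fin K) (Fin K) ℝ)).det ^ 2 * (vol G ^ 2) ^ D) := by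
  have hD : 0 < D := Nat.pos_of_ne_zero M.pos
  let e : Fin (D * K) ≃ Fin D × Fin K := finProdFinEquiv.symm
  have hlt : ∀ i : Fin (D * K), (i : ℕ) / D < K := fun i =>
    Nat.div_lt_of_lt_mul i.2
  have h := prod_sq_le_hermiteConst_pow_mul_det_gram (mul_ne_zero M.pos hK)
    (v := M.latticeBasis G ∘ e) ((M.linearIndependent_latticeBasis hG).comp e e.injective)
    (l := fun i => succMin I G ((i : ℕ) / D + 1))
    (fun i j hij => succMin_mono M.zero_mem M.one_mem hG (Nat.le_add_left _ _)
      (Nat.succ_le_succ (Nat.div_le_div_right hij)) (hlt j))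
    (fun i => hpos _ (hlt i)) (fun i => by
      have hset : {x | (∃ z : Fin (D * K) → ℤ, x = ∑ j, (z j : ℝ) • (M.latticeBasis G ∘ e) j) ∧
          ‖x‖ < succMin I G ((i : ℕ) / D + 1)} ⊆ M.toEuclidean N ''
            (latticePoints I G ∩ {v | euclNorm v < succMin I G ((i : ℕ) / D + 1)}) := by
        rintro x ⟨⟨z, hz⟩, hx⟩
        obtain ⟨y, rfl⟩ := (M.toEuclidean N).surjective x
        refine ⟨y, ⟨(M.mem_latticePoints_iff G y).2 ⟨z ∘ e.symm, ?_⟩, ?_⟩, rfl⟩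
        · rw [hz, ← e.sum_comp]
          simp
        · rwa [norm_toEuclidean] at hx
      calc _ ≤ _ := Submodule.finrank_mono (Submodule.span_mono hset)
        _ ≤ D * _ := M.finrank_span_image_toEuclidean_le _
        _ ≤ D * ((i : ℕ) / D) := Nat.mul_le_mul_left _
            (Nat.lt_succ_iff.1 (finrank_span_lt_succMin (Nat.le_add_left _ _)))
        _ ≤ i := Nat.mul_div_le _ _)
  have hgram : (Matrix.gram ℝ (M.latticeBasis G ∘ e)).det =
      (Matrix.gram ℝ (M.latticeBasis G)).det :=
    Matrix.det_submatrix_equiv_self e (Matrix.gram ℝ (M.latticeBasis G))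
  rw [hgram, det_gram_latticeBasis, Fin.prod_univ_eq_prod_range
    (fun i => succMin I G (i / D + 1)) (D * K),
    prod_range_div (fun k => succMin I G (k + 1)) M.pos] at h
  exact h

/-- Minkowski's second theorem over `𝕂`. -/
theorem prod_succMin_sq_le (M : RealModel I B) (hG : IsGenerator G) :
    (∏ k ∈ Finset.range K, succMin I G (k + 1)) ^ 2 ≤
      hermiteConst (D * K) ^ K *
        |(B ⊗ₖ (1 : Matrix (Fin K) (Fin K) ℝ)).det| ^ ((2 : ℝ) / D) * vol G ^ 2 := by
  have hη := hermiteConst_nonneg (D * K)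
  have hD : (D : ℝ) ≠ 0 := by exact_mod_cast M.pos
  have hpow : (hermiteConst (D * K) ^ K *
      |(B ⊗ₖ (1 : Matrix (Fin K) (Fin K) ℝ)).det| ^ ((2 : ℝ) / D) * vol G ^ 2) ^ D =
      hermiteConst (D * K) ^ (D * K) *
        ((B ⊗ₖ (1 : Matrix (Fin K) (Fin K) ℝ)).det ^ 2 * (vol G ^ 2) ^ D) := by
    rw [mul_pow, mul_pow, ← pow_mul, mul_comm K D, ← Real.rpow_mul_natCast (abs_nonneg _),
      div_mul_cancel₀ _ hD, Real.rpow_two, sq_abs, mul_assoc]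
  rcases eq_or_ne K 0 with rfl | hK
  · refine le_of_pow_le_pow_left₀ M.pos (by positivity) ?_
    have h := M.det_gram_latticeBasis G
    rw [Matrix.det_isEmpty] at h
    rw [hpow, ← h]
    simp
  by_cases hpos : ∀ k < K, 0 < succMin I G (k + 1)
  · refine le_of_pow_le_pow_left₀ M.pos (by positivity) ?_
    rw [hpow, pow_right_comm]
    exact M.prod_succMin_pow_le hK hG hpos
  -- If some successive minimum were zero, the left-hand side would vanish.
  · push Not at hpos
    obtain ⟨k, hk, hk0⟩ := hpos
    have h0 : succMin I G (k + 1) = 0 := le_antisymm hk0 (succMin_nonneg (Nat.le_add_left _ _))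
    rw [Finset.prod_eq_zero (f := fun k => succMin I G (k + 1)) (Finset.mem_range.2 hk) h0,
      zero_pow two_ne_zero]
    positivity

/-- The bound for the first `L` successive minima: their geometric mean is at most that of all of
them. -/
theorem prod_Icc_succMin_sq_le (M : RealModel I B) (hG : IsGenerator G) {L : ℕ} (hL : 1 ≤ L)
    (hLK : L ≤ K) :
    ∏ l ∈ Finset.Icc 1 L, succMin I G l ^ 2 ≤
      hermiteConst (D * K) ^ L *
        |(B ⊗ₖ (1 : Matrix (Fin K) (Fin K) ℝ)).det| ^ ((2 * L : ℝ) / (D * K)) *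
          vol G ^ ((2 * L : ℝ) / K) := by
  have hη := hermiteConst_nonneg (D * K)
  have hv : 0 < vol G := M.vol_pos hG
  have hK : K ≠ 0 := by omega
  have hK' : (K : ℝ) ≠ 0 := by exact_mod_cast hK
  have hD : (D : ℝ) ≠ 0 := by exact_mod_cast M.pos
  have h1 := prod_pow_le_prod_pow (a := fun k => succMin I G (k + 1) ^ 2) hLK
    (fun k => sq_nonneg _) (fun k l hkl hl => pow_le_pow_left₀ (succMin_nonneg (Nat.le_add_left _ _))
      (succMin_mono M.zero_mem M.one_mem hG (Nat.le_add_left _ _) (Nat.succ_le_succ hkl) hl) 2)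
  have h2 := M.prod_succMin_sq_le hG
  rw [← Finset.prod_pow] at h2
  rw [prod_Icc_one_eq_prod_range (fun l => succMin I G l ^ 2)]
  refine le_of_pow_le_pow_left₀ hK (by positivity)
    ((h1.trans (pow_le_pow_left₀ (Finset.prod_nonneg fun _ _ => sq_nonneg _) h2 L)).trans_eq ?_)
  rw [mul_pow, mul_pow, mul_pow, mul_pow, pow_right_comm, ← Real.rpow_mul_natCast (abs_nonneg _),
    ← Real.rpow_mul_natCast (abs_nonneg _), ← Real.rpow_mul_natCast hv.le,
    div_mul_cancel₀ _ hK', ← Real.rpow_two, ← Real.rpow_mul_natCast hv.le]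
  congr 3
  field_simp

theorem orthDefect_le (M : RealModel I B) (hG : IsGenerator G) {T : Matrix (Fin K) (Fin K) 𝕂}
    (hT : IsShortestIndependent I G T) :
    orthDefect (G * T) ≤ hermiteConst (D * K) ^ ((K : ℝ) / 2) *
      |(B ⊗ₖ (1 : Matrix (Fin K) (Fin K) ℝ)).det| ^ ((1 : ℝ) / D) := by
  obtain ⟨hTI, hGT, hnorm⟩ := hT
  have hη := hermiteConst_nonneg (D * K)
  have hv : 0 < vol G := M.vol_pos hG
  have hP : ∏ k, euclNorm ((G * T).col k) = ∏ k ∈ Finset.range K, succMin I G (k + 1) := by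
    rw [← Fin.prod_univ_eq_prod_range (fun k => succMin I G (k + 1)) K]
    exact Finset.prod_congr rfl fun k _ => hnorm k
  have hP0 : 0 ≤ ∏ k ∈ Finset.range K, succMin I G (k + 1) :=
    Finset.prod_nonneg fun _ _ => succMin_nonneg (Nat.le_add_left _ _)
  rw [orthDefect, hP]
  refine (div_le_div_of_nonneg_left hP0 hv (M.vol_le_vol_mul hTI hGT)).trans ?_
  rw [div_le_iff₀ hv]
  refine le_of_pow_le_pow_left₀ two_ne_zero (by positivity)
    ((M.prod_succMin_sq_le hG).trans_eq ?_)
  rw [mul_pow, mul_pow, ← Real.rpow_mul_natCast hη, ← Real.rpow_mul_natCast (abs_nonneg _),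
    ← Real.rpow_natCast (hermiteConst _) K]
  congr 3
  · push_cast; ring
  · push_cast; ring

end RealModel

/-! ### Real coordinates for the five integer rings -/

/-- The model for the integers. -/
noncomputable def intModel : RealModel IntegerRing.int.elements IntegerRing.int.baseMatrix where
  coord := (LinearEquiv.funUnique (Fin 1) ℝ ℝ).symm
  pos := one_ne_zero
  det_ne_zero := Matrix.det_one.trans_ne one_ne_zero
  sum_coord_sq x := (Fin.sum_univ_one _).trans (sq_abs x).symm
  coord_mul_dotProduct c x y := by
    change ∑ i : Fin 1, (c * x) * y = ∑ i : Fin 1, x * (c * y)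
    simp only [Finset.univ_unique, Finset.sum_singleton]
    ring
  mem_iff x := by
    change x ∈ Set.range ((↑) : ℤ → ℝ) ↔ ∃ z : Fin 1 → ℤ, (fun _ => x) =
      (1 : Matrix (Fin 1) (Fin 1) ℝ) *ᵥ fun a => (z a : ℝ)
    simp only [Matrix.one_mulVec]
    constructor
    · rintro ⟨z, rfl⟩
      exact ⟨fun _ => z, rfl⟩
    · rintro ⟨z, hz⟩
      exact ⟨z 0, (congrFun hz 0).symm⟩
  one_mem := ⟨1, Int.cast_one⟩
  mul_mem := by
    rintro _ ⟨x, rfl⟩ _ ⟨y, rfl⟩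
    exact ⟨x * y, Int.cast_mul x y⟩
  hdet_nonneg G := (Matrix.posSemidef_conjTranspose_mul_self G).det_nonneg
  hdet_pow G := (pow_one _).trans (LinearMap.det_toLin' _).symm

section Complex

open scoped ComplexOrder

/-- The real and the imaginary part as coordinates of a complex number. -/
noncomputable def complexCoord : ℂ ≃ₗ[ℝ] (Fin 2 → ℝ) where
  toFun c := ![c.re, c.im]
  map_add' x y := by ext i; fin_cases i <;> simp
  map_smul' c x := by ext i; fin_cases i <;> simp
  invFun y := ⟨y 0, y 1⟩
  left_inv x := by simp
  right_inv y := by ext i; fin_cases i <;> simp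

theorem complexCoord_apply (c : ℂ) : complexCoord c = ![c.re, c.im] := rfl

theorem det_realMulVec_complex {n : ℕ} (A : Matrix (Fin n) (Fin n) ℂ) :
    LinearMap.det (realMulVec A) = ‖A.det‖ ^ 2 := by
  have h : realMulVec A = (Matrix.toLin' A).restrictScalars ℝ := rfl
  rw [h, LinearMap.det_restrictScalars, LinearMap.det_toLin', Algebra.norm_complex_apply,
    Complex.normSq_eq_norm_sq]

/-- The model for a ring of complex integers. -/
noncomputable def complexModel (I : Set ℂ) (B : Matrix (Fin 2) (Fin 2) ℝ) (hB : B.det ≠ 0)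
    (hI : ∀ x, x ∈ I ↔ ∃ z : Fin 2 → ℤ, complexCoord x = B *ᵥ fun a => (z a : ℝ))
    (h1 : 1 ∈ I) (hmul : ∀ x ∈ I, ∀ y ∈ I, x * y ∈ I) : RealModel I B where
  coord := complexCoord
  pos := two_ne_zero
  det_ne_zero := hB
  sum_coord_sq x := by
    simp only [complexCoord_apply, Fin.sum_univ_two, ← Complex.normSq_eq_norm_sq,
      Complex.normSq_apply, Matrix.cons_val_zero, Matrix.cons_val_one]
    ring
  coord_mul_dotProduct c x y := by
    simp [complexCoord_apply, dotProduct, Fin.sum_univ_two]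
    ring
  mem_iff := hI
  one_mem := h1
  mul_mem := hmul
  hdet_nonneg G := (Complex.le_def.1 (Matrix.posSemidef_conjTranspose_mul_self G).det_nonneg).1
  hdet_pow G := by
    rw [det_realMulVec_complex]
    -- The determinant of a Gram matrix is a nonnegative real number.
    have h := (Complex.le_def.1 (Matrix.posSemidef_conjTranspose_mul_self G).det_nonneg).2
    change (Gᴴ * G).det.re ^ 2 = _
    rw [← Complex.normSq_eq_norm_sq, Complex.normSq_apply, ← h, Complex.zero_im]
    ring

/-- The model for the Gaussian integers. -/
noncomputable def gaussModel : RealModel IntegerRing.gauss.elements IntegerRing.gauss.baseMatrix :=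
  complexModel {c : ℂ | ∃ a b : ℤ, c = a + b * Complex.I} 1 (by simp)
    (fun x => by
      simp only [Matrix.one_mulVec, complexCoord_apply]
      constructor
      · rintro ⟨a, b, rfl⟩
        exact ⟨![a, b], by ext i; fin_cases i <;> simp⟩
      · rintro ⟨z, hz⟩
        have h0 := congrFun hz 0
        have h1 := congrFun hz 1
        exact ⟨z 0, z 1, by apply Complex.ext <;> simpa using by assumption⟩)
    ⟨1, 0, by simp⟩
    (by
      rintro _ ⟨a, b, rfl⟩ _ ⟨c, d, rfl⟩
      refine ⟨a * c - b * d, a * d + b * c, ?_⟩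
      push_cast
      linear_combination (b * d : ℂ) * Complex.I_mul_I)

theorem exp_two_pi_div_three :
    Complex.exp (2 * Real.pi / 3 * Complex.I) = ⟨-1 / 2, Real.sqrt 3 / 2⟩ := by
  have h : (2 * Real.pi / 3 : ℂ) = ((Real.pi - Real.pi / 3 : ℝ) : ℂ) := by push_cast; ring
  rw [h]
  apply Complex.ext
  · rw [Complex.exp_ofReal_mul_I_re, Real.cos_pi_sub, Real.cos_pi_div_three]; norm_num
  · rw [Complex.exp_ofReal_mul_I_im, Real.sin_pi_sub, Real.sin_pi_div_three]

/-- The model for the Eisenstein integers. -/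
noncomputable def eisensteinModel :
    RealModel IntegerRing.eisenstein.elements IntegerRing.eisenstein.baseMatrix :=
  complexModel {c : ℂ | ∃ a b : ℤ, c = a + b * Complex.exp (2 * Real.pi / 3 * Complex.I)}
    !![1, -1 / 2; 0, Real.sqrt 3 / 2] (by simp [Matrix.det_fin_two])
    (fun x => by
      simp only [complexCoord_apply, exp_two_pi_div_three]
      constructor
      · rintro ⟨a, b, rfl⟩
        exact ⟨![a, b], by ext i; fin_cases i <;> simp [Matrix.mulVec, dotProduct] <;> ring⟩
      · rintro ⟨z, hz⟩
        have h0 := congrFun hz 0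
        have h1 := congrFun hz 1
        simp [Matrix.mulVec, dotProduct] at h0 h1
        refine ⟨z 0, z 1, ?_⟩
        apply Complex.ext
        · simp [h0]; ring
        · simp [h1]; ring)
    ⟨1, 0, by simp⟩
    (by
      have hω : (⟨-1 / 2, Real.sqrt 3 / 2⟩ : ℂ) * ⟨-1 / 2, Real.sqrt 3 / 2⟩ =
          -1 - ⟨-1 / 2, Real.sqrt 3 / 2⟩ := by
        have h3 : Real.sqrt 3 * Real.sqrt 3 = 3 := Real.mul_self_sqrt (by norm_num)
        apply Complex.ext
        · simp; linear_combination (-1 / 4 : ℝ) * h3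
        · simp; ring
      simp only [exp_two_pi_div_three]
      rintro _ ⟨a, b, rfl⟩ _ ⟨c, d, rfl⟩
      refine ⟨a * c - b * d, a * d + b * c - b * d, ?_⟩
      push_cast
      linear_combination (b * d : ℂ) * hω)

end Complex

section Quaternion

/-- The four components as coordinates of a quaternion. -/
noncomputable def quatCoord : ℍ[ℝ] ≃ₗ[ℝ] (Fin 4 → ℝ) where
  toFun q := ![q.re, q.imI, q.imJ, q.imK]
  map_add' x y := by ext i; fin_cases i <;> simp
  map_smul' c x := by ext i; fin_cases i <;> simp
  invFun y := ⟨y 0, y 1, y 2, y 3⟩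
  left_inv _ := rfl
  right_inv y := by ext i; fin_cases i <;> simp

theorem quatCoord_apply (q : ℍ[ℝ]) : quatCoord q = ![q.re, q.imI, q.imJ, q.imK] := rfl

/-- Vectors `ζ₁ + ζ₂ j` of quaternions as complex vectors `(ζ₁, conj ζ₂)`. -/
noncomputable def quatVecEquiv (n : ℕ) : (Fin n → ℍ[ℝ]) ≃ₗ[ℝ] (Fin n ⊕ Fin n → ℂ) where
  toFun ζ := Sum.elim (fun i => quatFst (ζ i)) fun i => star (quatSnd (ζ i))
  map_add' x y := by
    ext i; rcases i with i | i <;> apply Complex.ext <;> simp [quatFst, quatSnd, add_comm]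
  map_smul' c x := by
    ext i; rcases i with i | i <;> apply Complex.ext <;> simp [quatFst, quatSnd]
  invFun z i := ⟨(z (Sum.inl i)).re, (z (Sum.inl i)).im, (z (Sum.inr i)).re, -(z (Sum.inr i)).im⟩
  left_inv x := by ext i <;> simp [quatFst, quatSnd]
  right_inv z := by
    ext i; rcases i with i | i <;> apply Complex.ext <;> simp [quatFst, quatSnd]

/-- Under `quatVecEquiv`, left multiplication by a quaternion matrix becomes multiplication by its
complex representation. -/
theorem quatVecEquiv_mulVec {n : ℕ} (A : Matrix (Fin n) (Fin n) ℍ[ℝ]) (ζ : Fin n → ℍ[ℝ]) :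
    quatVecEquiv n (A *ᵥ ζ) = complexRep A *ᵥ quatVecEquiv n ζ := by
  have hfst : ∀ p q : ℍ[ℝ], quatFst (p * q) =
      quatFst p * quatFst q - quatSnd p * star (quatSnd q) := fun p q => by
    apply Complex.ext <;> simp [quatFst, quatSnd] <;> ring
  have hsnd : ∀ p q : ℍ[ℝ], star (quatSnd (p * q)) =
      star (quatSnd p) * quatFst q + star (quatFst p) * star (quatSnd q) := fun p q => by
    apply Complex.ext <;> simp [quatFst, quatSnd] <;> ring
  have hfsum : ∀ f : Fin n → ℍ[ℝ], quatFst (∑ i, f i) = ∑ i, quatFst (f i) := fun f =>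
    map_sum (⟨⟨quatFst, rfl⟩, fun x y => by apply Complex.ext <;> simp [quatFst]⟩ : ℍ[ℝ] →+ ℂ)
      f Finset.univ
  have hssum : ∀ f : Fin n → ℍ[ℝ], star (quatSnd (∑ i, f i)) = ∑ i, star (quatSnd (f i)) :=
    fun f => map_sum (⟨⟨fun q => star (quatSnd q), by apply Complex.ext <;> simp [quatSnd]⟩,
      fun x y => by apply Complex.ext <;> simp [quatSnd, add_comm]⟩ : ℍ[ℝ] →+ ℂ) f Finset.univ
  ext i
  rcases i with i | i
  · change quatFst (∑ j, A i j * ζ j) = ∑ j : Fin n ⊕ Fin n, _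
    rw [hfsum, Fintype.sum_sum_type, ← Finset.sum_add_distrib]
    refine Finset.sum_congr rfl fun j _ => ?_
    rw [hfst, sub_eq_add_neg, ← neg_mul]
    rfl
  · change star (quatSnd (∑ j, A i j * ζ j)) = ∑ j : Fin n ⊕ Fin n, _
    rw [hssum, Fintype.sum_sum_type, ← Finset.sum_add_distrib]
    refine Finset.sum_congr rfl fun j _ => ?_
    rw [hsnd]
    rfl

theorem det_realMulVec_quaternion {n : ℕ} (A : Matrix (Fin n) (Fin n) ℍ[ℝ]) :
    LinearMap.det (realMulVec A) = ‖(complexRep A).det‖ ^ 2 := by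
  have h : (quatVecEquiv n : (Fin n → ℍ[ℝ]) →ₗ[ℝ] _) ∘ₗ realMulVec A ∘ₗ (quatVecEquiv n).symm =
      (Matrix.toLin' (complexRep A)).restrictScalars ℝ := by
    refine LinearMap.ext fun z => ?_
    obtain ⟨ζ, rfl⟩ := (quatVecEquiv n).surjective z
    change quatVecEquiv n (A *ᵥ ((quatVecEquiv n).symm (quatVecEquiv n ζ))) =
      complexRep A *ᵥ quatVecEquiv n ζ
    rw [LinearEquiv.symm_apply_apply, quatVecEquiv_mulVec]
  rw [← LinearMap.det_conj (realMulVec A) (quatVecEquiv n), h, LinearMap.det_restrictScalars,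
    LinearMap.det_toLin', Algebra.norm_complex_apply, Complex.normSq_eq_norm_sq]

/-- The model for a ring of quaternionic integers. -/
noncomputable def quatModel (I : Set ℍ[ℝ]) (B : Matrix (Fin 4) (Fin 4) ℝ) (hB : B.det ≠ 0)
    (hI : ∀ x, x ∈ I ↔ ∃ z : Fin 4 → ℤ, quatCoord x = B *ᵥ fun a => (z a : ℝ))
    (h1 : 1 ∈ I) (hmul : ∀ x ∈ I, ∀ y ∈ I, x * y ∈ I) : RealModel I B where
  coord := quatCoord
  pos := four_ne_zero
  det_ne_zero := hB
  sum_coord_sq x := by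
    rw [sq ‖x‖, ← Quaternion.normSq_eq_norm_mul_self, Quaternion.normSq_def']
    simp [quatCoord_apply, Fin.sum_univ_four]
  coord_mul_dotProduct c x y := by
    simp [quatCoord_apply, dotProduct, Fin.sum_univ_four]
    ring
  mem_iff := hI
  one_mem := h1
  mul_mem := hmul
  hdet_nonneg G := Real.sqrt_nonneg _
  hdet_pow G := by
    rw [det_realMulVec_quaternion]
    change Real.sqrt ‖(complexRep (Gᴴ * G)).det‖ ^ (2 * 2) = _
    rw [pow_mul, Real.sq_sqrt (norm_nonneg _)]

/-- The model for the Lipschitz integers. -/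
noncomputable def lipschitzModel : RealModel IntegerRing.lipschitz.elements IntegerRing.lipschitz.baseMatrix :=
  quatModel {q : ℍ[ℝ] | ∃ a b c d : ℤ, q = ⟨a, b, c, d⟩} 1 (by simp)
    (fun x => by
      simp only [Matrix.one_mulVec, quatCoord_apply]
      constructor
      · rintro ⟨a, b, c, d, rfl⟩
        exact ⟨![a, b, c, d], by ext i; fin_cases i <;> simp⟩
      · rintro ⟨z, hz⟩
        exact ⟨z 0, z 1, z 2, z 3, QuaternionAlgebra.ext (congrFun hz 0) (congrFun hz 1)
          (congrFun hz 2) (congrFun hz 3)⟩)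
    ⟨1, 0, 0, 0, by ext <;> simp⟩
    (by
      rintro _ ⟨a, b, c, d, rfl⟩ _ ⟨a', b', c', d', rfl⟩
      refine ⟨a * a' - b * b' - c * c' - d * d', a * b' + b * a' + c * d' - d * c',
        a * c' - b * d' + c * a' + d * b', a * d' + b * c' - c * b' + d * a', ?_⟩
      push_cast
      ext
      · exact Quaternion.re_mul _ _
      · exact Quaternion.imI_mul _ _
      · exact Quaternion.imJ_mul _ _
      · exact Quaternion.imK_mul _ _)

/-- The Hurwitz integers are the combinations of `1`, `i`, `j` and `(1 + i + j + k) / 2` with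
integer coefficients. -/
theorem mem_hurwitz_iff (q : ℍ[ℝ]) :
    ((∃ a b c d : ℤ, q = ⟨a, b, c, d⟩) ∨
      ∃ a b c d : ℤ, q = ⟨a + 1 / 2, b + 1 / 2, c + 1 / 2, d + 1 / 2⟩) ↔
    ∃ a b c d : ℤ, q = ⟨a + d / 2, b + d / 2, c + d / 2, d / 2⟩ := by
  constructor
  · rintro (⟨a, b, c, d, rfl⟩ | ⟨a, b, c, d, rfl⟩)
    · exact ⟨a - d, b - d, c - d, 2 * d, by ext <;> simp⟩
    · refine ⟨a - d, b - d, c - d, 2 * d + 1, ?_⟩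
      ext <;> simp <;> ring
  · rintro ⟨a, b, c, d, rfl⟩
    rcases Int.even_or_odd' d with ⟨m, rfl | rfl⟩
    · exact Or.inl ⟨a + m, b + m, c + m, m, by ext <;> simp⟩
    · refine Or.inr ⟨a + m, b + m, c + m, m, ?_⟩
      ext <;> simp <;> ring

/-- The model for the Hurwitz integers. -/
noncomputable def hurwitzModel : RealModel IntegerRing.hurwitz.elements IntegerRing.hurwitz.baseMatrix :=
  quatModel {q : ℍ[ℝ] | (∃ a b c d : ℤ, q = ⟨a, b, c, d⟩) ∨
      ∃ a b c d : ℤ, q = ⟨a + 1 / 2, b + 1 / 2, c + 1 / 2, d + 1 / 2⟩}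
    !![1, 0, 0, 1 / 2; 0, 1, 0, 1 / 2; 0, 0, 1, 1 / 2; 0, 0, 0, 1 / 2]
    (by simp [Matrix.det_succ_row_zero, Fin.sum_univ_succ])
    (fun x => by
      rw [Set.mem_ofPred_eq, mem_hurwitz_iff, quatCoord_apply]
      constructor
      · rintro ⟨a, b, c, d, rfl⟩
        refine ⟨![a, b, c, d], ?_⟩
        ext i
        fin_cases i <;> simp [Matrix.mulVec, dotProduct, Fin.sum_univ_four] <;> ring
      · rintro ⟨z, hz⟩
        have h0 := congrFun hz 0
        have h1 := congrFun hz 1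
        have h2 := congrFun hz 2
        have h3 := congrFun hz 3
        simp [Matrix.mulVec, dotProduct, Fin.sum_univ_four] at h0 h1 h2 h3
        refine ⟨z 0, z 1, z 2, z 3, ?_⟩
        ext
        · simp [h0]; ring
        · simp [h1]; ring
        · simp [h2]; ring
        · simp [h3]; ring)
    (Or.inl ⟨1, 0, 0, 0, by ext <;> simp⟩)
    (by
      simp only [Set.mem_ofPred_eq, mem_hurwitz_iff]
      rintro _ ⟨a, b, c, d, rfl⟩ _ ⟨a', b', c', d', rfl⟩
      refine ⟨a * a' - b * b' - c * c' - b * c' + c * b' - b * d' - d * c' - d * d',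
        a * b' + b * a' - b * c' + c * b' + d * b' + c * d' - d * c',
        a * c' + c * a' - b * c' + c * b' - b * d' + c * d' + d * b',
        2 * b * c' - 2 * c * b' + a * d' + b * d' + d * c' - c * d' - d * b' + d * a' + d * d',
        ?_⟩
      push_cast
      ext
      · exact (Quaternion.re_mul _ _).trans (by dsimp only; ring)
      · exact (Quaternion.imI_mul _ _).trans (by dsimp only; ring)
      · exact (Quaternion.imJ_mul _ _).trans (by dsimp only; ring)
      · exact (Quaternion.imK_mul _ _).trans (by dsimp only; ring))

end Quaternion

end GenLattice

theorem theorem5 (I : IntegerRing) (N K : ℕ) (G : Matrix (Fin N) (Fin K) I.Scalar)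
    (hG : IsGenerator G) :
    (∀ L : ℕ, 1 ≤ L → L ≤ K →
      ∏ l ∈ Finset.Icc 1 L, succMin I.elements G l ^ 2 ≤
        hermiteConst (I.realDim * K) ^ L *
          |(I.genMatrix K).det| ^ ((2 * L : ℝ) / (I.realDim * K)) *
          vol G ^ ((2 * L : ℝ) / K)) ∧
    ∀ T : Matrix (Fin K) (Fin K) I.Scalar, IsShortestIndependent I.elements G T →
      orthDefect (G * T) ≤
        hermiteConst (I.realDim * K) ^ ((K : ℝ) / 2) *
          |(I.genMatrix K).det| ^ ((1 : ℝ) / I.realDim) := by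
  cases I with
  | int => exact ⟨fun L hL hLK => intModel.prod_Icc_succMin_sq_le hG hL hLK,
      fun T hT => intModel.orthDefect_le hG hT⟩
  | gauss => exact ⟨fun L hL hLK => gaussModel.prod_Icc_succMin_sq_le hG hL hLK,
      fun T hT => gaussModel.orthDefect_le hG hT⟩
  | eisenstein => exact ⟨fun L hL hLK => eisensteinModel.prod_Icc_succMin_sq_le hG hL hLK,
      fun T hT => eisensteinModel.orthDefect_le hG hT⟩
  | lipschitz => exact ⟨fun L hL hLK => lipschitzModel.prod_Icc_succMin_sq_le hG hL hLK,
      fun T hT => lipschitzModel.orthDefect_le hG hT⟩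
  | hurwitz => exact ⟨fun L hL hLK => hurwitzModel.prod_Icc_succMin_sq_le hG hL hLK,
      fun T hT => hurwitzModel.orthDefect_le hG hT⟩
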